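/- A $C^\infty$-ring is a set $A$ in which every smooth function $f\colon\mathbb R^n\to\mathbb R$ ($n\ge 0$) acts as an $n$-ary operation $A^n\to A$, compatibly with coordinate projections and composition of smooth maps (equivalently, a product preserving functor to sets from the category of the spaces $\mathbb R^n$ and smooth maps). It has an underlying commutative $\mathbb R$-algebra; an ideal of $A$ is an ideal of this algebra, and $A/I$ is again a $C^\infty$-ring. For $a\in A$ let $A\to A\{a^{-1}\}$ be the initial morphism of $C^\infty$-rings under which $a$ becomes invertible. For an ideal $I$ of $A$ put - $\sqrt{I}=\{f\in A : f^k\in I \text{ for some } k\in\mathbb Z_{>0}\}$ (the nilradical of $I$), - $\sqrt[\infty]{I}=\{f\in A : (A/I)\{f^{-1}\}\cong 0\}$ (the $\infty$-radical of $I$), where $f$ also denotes its class in $A/I$, - $J(I)=$ the intersection of all maximal ideals of $A$ containing $I$ (the Jacobson radical of $I$), - $J_{\mathbb R}(I)=$ the intersection of all maximal ideals $\mathfrak m\supseteq I$ of $A$ with residue field $A/\mathfrak m\cong\mathbb R$ as an $\mathbb R$-algebra (the $\mathbb R$-Jacobson radical of $I$). An empty intersection is $A$. **Proposition.** For every $C^\infty$-ring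 $A$ and every ideal $I$ of $A$, $$\sqrt{I}\subseteq\sqrt[\infty]{I}\subseteq J(I)\subseteq J_{\mathbb R}(I),$$ and each of these inclusions can be strict. Namely, in $C^\infty(\mathbb R)$: 1. if $I$ is the ideal of functions that are flat at $0$ (all derivatives of order $\ge 0$ vanish at $0$), then $\sqrt{I}\subsetneq\sqrt[\infty]{I}$; 2. if $I$ is the ideal of functions that vanish in a neighbourhood of $0$ (zero germ at $0$), then $\sqrt[\infty]{I}\subsetneq J(I)$; 3. if $I$ is the ideal of functions with compact support, then $J(I)\subsetneq J_{\mathbb R}(I)$. -/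

import Mathlib

open scoped ContDiff Manifold Topology

noncomputable section

/-! ### `C^∞`-rings -/

/-- A `C^∞`-ring, as a model of the algebraic theory whose objects are the spaces `ℝⁿ` and whose
morphisms are the smooth maps: every smooth `f : ℝⁿ → ℝ` acts as an `n`-ary operation on `A`,
compatibly with the coordinate projections and with composition. -/
class SmoothOps (A : Type*) where
  op : {n : ℕ} → (f : (Fin n → ℝ) → ℝ) → ContDiff ℝ ∞ f → (Fin n → A) → A
  op_proj : ∀ {n : ℕ} (i : Fin n) (h : ContDiff ℝ ∞ (fun x : Fin n → ℝ => x i)) (v : Fin n → A),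
    op (fun x : Fin n → ℝ => x i) h v = v i
  op_comp : ∀ {m n : ℕ} (f : (Fin m → ℝ) → ℝ) (hf : ContDiff ℝ ∞ f)
    (g : Fin m → (Fin n → ℝ) → ℝ) (hg : ∀ i, ContDiff ℝ ∞ (g i))
    (h : ContDiff ℝ ∞ (fun x => f (fun i => g i x))) (v : Fin n → A),
    op (fun x => f (fun i => g i x)) h v = op f hf (fun i => op (g i) (hg i) v)

/-- A `C^∞`-ring together with its underlying commutative `ℝ`-algebra. The last three fields say
that the algebra structure is the one given by the operations `x + y`, `x * y` and the constants;
so it is determined by the operations, and it always exists, see `SmoothOps.toCommRing`,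
`SmoothOps.toAlgebra` and `SmoothOps.toCInfRing` below. -/
class CInfRing (A : Type*) [CommRing A] [Algebra ℝ A] extends SmoothOps A where
  op_add : ∀ (h : ContDiff ℝ ∞ (fun x : Fin 2 → ℝ => x 0 + x 1)) (v : Fin 2 → A),
    op (fun x : Fin 2 → ℝ => x 0 + x 1) h v = v 0 + v 1
  op_mul : ∀ (h : ContDiff ℝ ∞ (fun x : Fin 2 → ℝ => x 0 * x 1)) (v : Fin 2 → A),
    op (fun x : Fin 2 → ℝ => x 0 * x 1) h v = v 0 * v 1
  op_const : ∀ (c : ℝ) (h : ContDiff ℝ ∞ (fun _ : Fin 0 → ℝ => c)) (v : Fin 0 → A),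
    op (fun _ : Fin 0 → ℝ => c) h v = algebraMap ℝ A c

/-! ### The underlying `ℝ`-algebra of a model of the theory -/

namespace SmoothOps

variable {A : Type*} [SmoothOps A]

theorem op_congr {n : ℕ} {f g : (Fin n → ℝ) → ℝ} (hf : ContDiff ℝ ∞ f) (hg : ContDiff ℝ ∞ g)
    (h : ∀ x, f x = g x) (v : Fin n → A) : op f hf v = op g hg v := by
  obtain rfl : f = g := funext h
  rfl

/-- The sum in the underlying ring. -/
def add (a b : A) : A := op (fun x : Fin 2 → ℝ => x 0 + x 1) (by fun_prop) ![a, b]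

/-- The product in the underlying ring. -/
def mul (a b : A) : A := op (fun x : Fin 2 → ℝ => x 0 * x 1) (by fun_prop) ![a, b]

/-- The negative in the underlying ring. -/
def neg (a : A) : A := op (fun x : Fin 1 → ℝ => - x 0) (by fun_prop) ![a]

variable (A) in
/-- The constants in the underlying ring. -/
def const (c : ℝ) : A := op (fun _ : Fin 0 → ℝ => c) contDiff_const ![]

theorem add_op {n : ℕ} {f g : (Fin n → ℝ) → ℝ} (hf : ContDiff ℝ ∞ f) (hg : ContDiff ℝ ∞ g)
    (v : Fin n → A) : add (op f hf v) (op g hg v) = op (fun x => f x + g x) (hf.add hg) v := by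
  have hfg : ∀ i : Fin 2, ContDiff ℝ ∞ ((![f, g] : Fin 2 → (Fin n → ℝ) → ℝ) i) := by
    intro i; fin_cases i <;> assumption
  refine Eq.trans ?_ (op_comp (fun x : Fin 2 → ℝ => x 0 + x 1) (by fun_prop) ![f, g] hfg
    (hf.add hg) v).symm
  unfold add
  congr 1
  funext i
  fin_cases i <;> rfl

theorem mul_op {n : ℕ} {f g : (Fin n → ℝ) → ℝ} (hf : ContDiff ℝ ∞ f) (hg : ContDiff ℝ ∞ g)
    (v : Fin n → A) : mul (op f hf v) (op g hg v) = op (fun x => f x * g x) (hf.mul hg) v := by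
  have hfg : ∀ i : Fin 2, ContDiff ℝ ∞ ((![f, g] : Fin 2 → (Fin n → ℝ) → ℝ) i) := by
    intro i; fin_cases i <;> assumption
  refine Eq.trans ?_ (op_comp (fun x : Fin 2 → ℝ => x 0 * x 1) (by fun_prop) ![f, g] hfg
    (hf.mul hg) v).symm
  unfold mul
  congr 1
  funext i
  fin_cases i <;> rfl

theorem neg_op {n : ℕ} {f : (Fin n → ℝ) → ℝ} (hf : ContDiff ℝ ∞ f)
    (v : Fin n → A) : neg (op f hf v) = op (fun x => - f x) hf.neg v := by
  refine Eq.trans ?_ (op_comp (fun x : Fin 1 → ℝ => - x 0) (by fun_prop) ![f]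
    (by intro i; fin_cases i; exact hf) hf.neg v).symm
  unfold neg
  congr 1
  funext i
  fin_cases i; rfl

theorem const_op (c : ℝ) {n : ℕ} (v : Fin n → A) :
    const A c = op (fun _ : Fin n → ℝ => c) contDiff_const v := by
  refine Eq.trans ?_ (op_comp (fun _ : Fin 0 → ℝ => c) contDiff_const
    (fun i => i.elim0) (fun i => i.elim0) contDiff_const v).symm
  unfold const
  congr 1
  funext i
  exact i.elim0

theorem eq_op {n : ℕ} (v : Fin n → A) (i : Fin n) :
    v i = op (fun x : Fin n → ℝ => x i) (by fun_prop) v := (op_proj i _ v).symm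

/-- The underlying commutative ring of a model of the theory. -/
@[reducible]
def toCommRing (A : Type*) [SmoothOps A] : CommRing A :=
  letI : Zero A := ⟨const A 0⟩
  letI : One A := ⟨const A 1⟩
  letI : Add A := ⟨add⟩
  letI : Mul A := ⟨mul⟩
  letI : Neg A := ⟨neg⟩
  { nsmul := nsmulRec
    zsmul := zsmulRec
    add_assoc := fun a b c => by
      have key : ∀ v : Fin 3 → A, add (add (v 0) (v 1)) (v 2) = add (v 0) (add (v 1) (v 2)) := by
        intro v
        rw [eq_op v 0, eq_op v 1, eq_op v 2]
        simp only [add_op]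
        exact op_congr _ _ (fun x => by ring) _
      exact key ![a, b, c]
    add_comm := fun a b => by
      have key : ∀ v : Fin 2 → A, add (v 0) (v 1) = add (v 1) (v 0) := by
        intro v
        rw [eq_op v 0, eq_op v 1]
        simp only [add_op]
        exact op_congr _ _ (fun x => by ring) _
      exact key ![a, b]
    zero_add := fun a => by
      have key : ∀ v : Fin 1 → A, add (const A 0) (v 0) = (v 0) := by
        intro v
        rw [eq_op v 0, const_op _ v]
        simp only [add_op]
        exact op_congr _ _ (fun x => by ring) _
      exact key ![a]
    add_zero := fun a => by
      have key : ∀ v : Fin 1 → A, add (v 0) (const A 0) = (v 0) := by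
        intro v
        rw [eq_op v 0, const_op _ v]
        simp only [add_op]
        exact op_congr _ _ (fun x => by ring) _
      exact key ![a]
    neg_add_cancel := fun a => by
      have key : ∀ v : Fin 1 → A, add (neg (v 0)) (v 0) = const A 0 := by
        intro v
        rw [eq_op v 0, const_op _ v]
        simp only [add_op, neg_op]
        exact op_congr _ _ (fun x => by ring) _
      exact key ![a]
    mul_assoc := fun a b c => by
      have key : ∀ v : Fin 3 → A, mul (mul (v 0) (v 1)) (v 2) = mul (v 0) (mul (v 1) (v 2)) := by
        intro v
        rw [eq_op v 0, eq_op v 1, eq_op v 2]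
        simp only [mul_op]
        exact op_congr _ _ (fun x => by ring) _
      exact key ![a, b, c]
    mul_comm := fun a b => by
      have key : ∀ v : Fin 2 → A, mul (v 0) (v 1) = mul (v 1) (v 0) := by
        intro v
        rw [eq_op v 0, eq_op v 1]
        simp only [mul_op]
        exact op_congr _ _ (fun x => by ring) _
      exact key ![a, b]
    one_mul := fun a => by
      have key : ∀ v : Fin 1 → A, mul (const A 1) (v 0) = (v 0) := by
        intro v
        rw [eq_op v 0, const_op _ v]
        simp only [mul_op]
        exact op_congr _ _ (fun x => by ring) _
      exact key ![a]
    mul_one := fun a => by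
      have key : ∀ v : Fin 1 → A, mul (v 0) (const A 1) = (v 0) := by
        intro v
        rw [eq_op v 0, const_op _ v]
        simp only [mul_op]
        exact op_congr _ _ (fun x => by ring) _
      exact key ![a]
    zero_mul := fun a => by
      have key : ∀ v : Fin 1 → A, mul (const A 0) (v 0) = const A 0 := by
        intro v
        rw [eq_op v 0, const_op _ v]
        simp only [mul_op]
        exact op_congr _ _ (fun x => by ring) _
      exact key ![a]
    mul_zero := fun a => by
      have key : ∀ v : Fin 1 → A, mul (v 0) (const A 0) = const A 0 := by
        intro v
        rw [eq_op v 0, const_op _ v]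
        simp only [mul_op]
        exact op_congr _ _ (fun x => by ring) _
      exact key ![a]
    left_distrib := fun a b c => by
      have key : ∀ v : Fin 3 → A, mul (v 0) (add (v 1) (v 2)) = add (mul (v 0) (v 1)) (mul (v 0) (v 2)) := by
        intro v
        rw [eq_op v 0, eq_op v 1, eq_op v 2]
        simp only [add_op, mul_op]
        exact op_congr _ _ (fun x => by ring) _
      exact key ![a, b, c]
    right_distrib := fun a b c => by
      have key : ∀ v : Fin 3 → A, mul (add (v 0) (v 1)) (v 2) = add (mul (v 0) (v 2)) (mul (v 1) (v 2)) := by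
        intro v
        rw [eq_op v 0, eq_op v 1, eq_op v 2]
        simp only [add_op, mul_op]
        exact op_congr _ _ (fun x => by ring) _
      exact key ![a, b, c] }

/-- The underlying `ℝ`-algebra of a model of the theory. -/
@[reducible]
def toAlgebra (A : Type*) [SmoothOps A] :
    letI : CommRing A := toCommRing A
    Algebra ℝ A :=
  letI : CommRing A := toCommRing A
  RingHom.toAlgebra
    { toFun := const A
      map_one' := rfl
      map_zero' := rfl
      map_add' := fun _ _ => (add_op contDiff_const contDiff_const ![]).symm
      map_mul' := fun _ _ => (mul_op contDiff_const contDiff_const ![]).symm }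

/-- Every model of the theory is a `C^∞`-ring with its underlying `ℝ`-algebra. -/
@[reducible]
def toCInfRing (A : Type*) [SmoothOps A] :
    letI : CommRing A := toCommRing A
    letI : Algebra ℝ A := toAlgebra A
    CInfRing A :=
  letI : CommRing A := toCommRing A
  letI : Algebra ℝ A := toAlgebra A
  { op_add := fun h v => by
      change _ = op _ _ ![v 0, v 1]
      congr 1
      funext i
      fin_cases i <;> rfl
    op_mul := fun h v => by
      change _ = op _ _ ![v 0, v 1]
      congr 1
      funext i
      fin_cases i <;> rfl
    op_const := fun c h v => (const_op c v).symm }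

end SmoothOps

/-! ### The quotient of a `C^∞`-ring by an ideal -/

namespace CInfRing

open SmoothOps

theorem contDiff_integral_nat {E : Type} [NormedAddCommGroup E] [NormedSpace ℝ E]
    [FiniteDimensional ℝ E] (k : ℕ) :
    ∀ {F : Type} [NormedAddCommGroup F] [NormedSpace ℝ F] [CompleteSpace F]
      (G : E × ℝ → F), ContDiff ℝ ∞ G →
      ContDiff ℝ k (fun x => ∫ t in (0 : ℝ)..1, G (x, t)) := by
  have key : ∀ {F : Type} [NormedAddCommGroup F] [NormedSpace ℝ F] [CompleteSpace F]
      (G : E × ℝ → F), ContDiff ℝ ∞ G → ∀ x : E,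
      HasFDerivAt (fun x => ∫ t in (0 : ℝ)..1, G (x, t))
        (∫ t in (0 : ℝ)..1,
          (fderiv ℝ G (x, t)).comp (ContinuousLinearMap.inl ℝ E ℝ)) x := by
    intro F _ _ _ G hG x
    have hd : Continuous (fun p : E × ℝ =>
        (fderiv ℝ G p).comp (ContinuousLinearMap.inl ℝ E ℝ)) :=
      (hG.continuous_fderiv (by simp)).clm_comp continuous_const
    obtain ⟨C, hC⟩ := ((isCompact_closedBall x 1).prod
      (isCompact_Icc (a := (0 : ℝ)) (b := 1))).exists_bound_of_continuousOn hd.continuousOn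
    refine intervalIntegral.hasFDerivAt_integral_of_dominated_of_fderiv_le
      (F := fun x t => G (x, t))
      (F' := fun x t => (fderiv ℝ G (x, t)).comp (ContinuousLinearMap.inl ℝ E ℝ))
      (s := Metric.closedBall x 1) (bound := fun _ => C)
      (Metric.closedBall_mem_nhds x one_pos) ?_ ?_ ?_ ?_ ?_ ?_
    · exact Filter.Eventually.of_forall fun y =>
        (hG.continuous.comp (by fun_prop : Continuous fun t : ℝ => (y, t))).aestronglyMeasurable
    · exact (hG.continuous.comp (by fun_prop : Continuous fun t : ℝ => (x, t))).intervalIntegrable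
        _ _
    · exact (hd.comp (by fun_prop : Continuous fun t : ℝ => (x, t))).aestronglyMeasurable
    · refine Filter.Eventually.of_forall fun t ht y hy => hC (y, t) ⟨hy, ?_⟩
      rw [Set.uIoc_of_le zero_le_one] at ht
      exact ⟨ht.1.le, ht.2⟩
    · exact intervalIntegrable_const
    · refine Filter.Eventually.of_forall fun t _ y _ => ?_
      have h1 : HasFDerivAt G (fderiv ℝ G (y, t)) (y, t) :=
        (hG.differentiable (by simp) _).hasFDerivAt
      exact h1.comp y (hasFDerivAt_prodMk_left y t)
  induction k with
  | zero =>
    intro F _ _ _ G hG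
    rw [Nat.cast_zero, contDiff_zero]
    exact continuous_iff_continuousAt.2 fun x => (key G hG x).continuousAt
  | succ k ih =>
    intro F _ _ _ G hG
    have := (contDiff_succ_iff_hasFDerivAt (𝕜 := ℝ) (n := k)
      (f := fun x => ∫ t in (0 : ℝ)..1, G (x, t))).2
      ⟨_, ih (fun p : E × ℝ => (fderiv ℝ G p).comp (ContinuousLinearMap.inl ℝ E ℝ))
        ((hG.fderiv_right (by simp)).clm_comp contDiff_const), key G hG⟩
    exact_mod_cast this

/-- Hadamard's lemma: `f(x) - f(y) = ∑ (xᵢ - yᵢ) hᵢ(x, y)` with smooth `hᵢ`. -/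
theorem exists_hadamard {n : ℕ} (f : (Fin n → ℝ) → ℝ) (hf : ContDiff ℝ ∞ f) :
    ∃ h : Fin n → (Fin (n + n) → ℝ) → ℝ, (∀ i, ContDiff ℝ ∞ (h i)) ∧
      ∀ z : Fin (n + n) → ℝ,
        f (fun i => z (Fin.castAdd n i)) - f (fun i => z (Fin.natAdd n i)) =
          ∑ i, (z (Fin.castAdd n i) - z (Fin.natAdd n i)) * h i z := by
  set γ : (Fin (n + n) → ℝ) × ℝ → Fin n → ℝ := fun p i =>
    p.1 (Fin.natAdd n i) + p.2 * (p.1 (Fin.castAdd n i) - p.1 (Fin.natAdd n i)) with hγ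
  have hγs : ContDiff ℝ ∞ γ := by
    rw [contDiff_pi]
    intro i
    have h1 : ∀ j, ContDiff ℝ ∞ (fun p : (Fin (n + n) → ℝ) × ℝ => p.1 j) := fun j =>
      (contDiff_apply ℝ ℝ j).comp contDiff_fst
    exact (h1 _).add (contDiff_snd.mul ((h1 _).sub (h1 _)))
  have hG : ∀ i : Fin n, ContDiff ℝ ∞ (fun p => fderiv ℝ f (γ p) (Pi.single i 1)) := fun i =>
    ((hf.fderiv_right (by simp)).comp hγs).clm_apply contDiff_const
  refine ⟨fun i z => ∫ t in (0 : ℝ)..1, fderiv ℝ f (γ (z, t)) (Pi.single i 1),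
    fun i => contDiff_infty.2 fun k => contDiff_integral_nat k _ (hG i), fun z => ?_⟩
  have hder : ∀ t : ℝ, HasDerivAt (fun t => f (γ (z, t)))
      (∑ i, (z (Fin.castAdd n i) - z (Fin.natAdd n i)) *
        fderiv ℝ f (γ (z, t)) (Pi.single i 1)) t := by
    intro t
    have h1 : HasDerivAt (fun t => γ (z, t))
        (fun i => z (Fin.castAdd n i) - z (Fin.natAdd n i)) t := by
      rw [hasDerivAt_pi]
      intro i
      simpa [hγ] using ((hasDerivAt_id t).mul_const
        (z (Fin.castAdd n i) - z (Fin.natAdd n i))).const_add (z (Fin.natAdd n i))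
    have h2 : HasFDerivAt f (fderiv ℝ f (γ (z, t))) (γ (z, t)) :=
      (hf.differentiable (by simp) _).hasFDerivAt
    have h3 := h2.comp_hasDerivAt t h1
    refine h3.congr_deriv ?_
    change (fderiv ℝ f (γ (z, t))).toLinearMap _ = _
    rw [LinearMap.pi_apply_eq_sum_univ (fderiv ℝ f (γ (z, t))).toLinearMap
      (fun i => z (Fin.castAdd n i) - z (Fin.natAdd n i))]
    refine Finset.sum_congr rfl fun i _ => ?_
    rw [smul_eq_mul, ContinuousLinearMap.coe_coe]
    congr 2
    funext j
    simp [Pi.single_apply, eq_comm]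
  have hc : ∀ i : Fin n, Continuous fun t : ℝ => fderiv ℝ f (γ (z, t)) (Pi.single i 1) :=
    fun i => (hG i).continuous.comp (by fun_prop : Continuous fun t : ℝ => (z, t))
  have hint := intervalIntegral.integral_eq_sub_of_hasDerivAt (a := 0) (b := 1)
    (fun t _ => hder t)
    ((continuous_finsetSum _ fun i _ => continuous_const.mul (hc i)).intervalIntegrable _ _)
  rw [intervalIntegral.integral_finsetSum
    (f := fun i t => (z (Fin.castAdd n i) - z (Fin.natAdd n i)) *
      fderiv ℝ f (γ (z, t)) (Pi.single i 1))
    (fun i _ => (continuous_const.mul (hc i)).intervalIntegrable _ _)] at hint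
  simp only [intervalIntegral.integral_const_mul] at hint
  rw [hint]
  simp [hγ]

variable {A : Type*} [CommRing A] [Algebra ℝ A] [CInfRing A]

theorem op_add_fun {n : ℕ} {f g : (Fin n → ℝ) → ℝ} (hf : ContDiff ℝ ∞ f) (hg : ContDiff ℝ ∞ g)
    (h : ContDiff ℝ ∞ (fun x => f x + g x)) (v : Fin n → A) :
    op (fun x => f x + g x) h v = op f hf v + op g hg v := by
  rw [← add_op hf hg]
  exact op_add _ _

theorem op_mul_fun {n : ℕ} {f g : (Fin n → ℝ) → ℝ} (hf : ContDiff ℝ ∞ f) (hg : ContDiff ℝ ∞ g)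
    (h : ContDiff ℝ ∞ (fun x => f x * g x)) (v : Fin n → A) :
    op (fun x => f x * g x) h v = op f hf v * op g hg v := by
  rw [← mul_op hf hg]
  exact op_mul _ _

theorem op_const_fun (c : ℝ) {n : ℕ} (h : ContDiff ℝ ∞ (fun _ : Fin n → ℝ => c))
    (v : Fin n → A) : op (fun _ : Fin n → ℝ => c) h v = algebraMap ℝ A c := by
  rw [← const_op c v]
  exact op_const _ _ _

theorem op_sub_fun {n : ℕ} {f g : (Fin n → ℝ) → ℝ} (hf : ContDiff ℝ ∞ f) (hg : ContDiff ℝ ∞ g)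
    (h : ContDiff ℝ ∞ (fun x => f x - g x)) (v : Fin n → A) :
    op (fun x => f x - g x) h v = op f hf v - op g hg v := by
  rw [eq_sub_iff_add_eq, ← op_add_fun h hg (h.add hg)]
  exact op_congr _ _ (fun x => by ring) _

theorem op_sum_fun {n : ℕ} {ι : Type*} (s : Finset ι) (f : ι → (Fin n → ℝ) → ℝ)
    (hf : ∀ i, ContDiff ℝ ∞ (f i)) (h : ContDiff ℝ ∞ (fun x => ∑ i ∈ s, f i x))
    (v : Fin n → A) :
    op (fun x => ∑ i ∈ s, f i x) h v = ∑ i ∈ s, op (f i) (hf i) v := by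
  classical
  induction s using Finset.induction_on with
  | empty =>
    rw [Finset.sum_empty, op_congr h (contDiff_const (c := (0 : ℝ))) (fun x => by simp),
      op_const_fun, map_zero]
  | insert a s ha ih =>
    have h' : ContDiff ℝ ∞ (fun x => ∑ i ∈ s, f i x) := ContDiff.sum fun i _ => hf i
    rw [Finset.sum_insert ha, ← ih h', ← op_add_fun (hf a) h' ((hf a).add h')]
    exact op_congr _ _ (fun x => by rw [Finset.sum_insert ha]) _

/-- Every ideal of the underlying ring is a congruence for all smooth operations. -/
theorem op_sub_op_mem (I : Ideal A) {n : ℕ} (f : (Fin n → ℝ) → ℝ) (hf : ContDiff ℝ ∞ f)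
    (v w : Fin n → A) (hvw : ∀ i, v i - w i ∈ I) : op f hf v - op f hf w ∈ I := by
  obtain ⟨h, hh, heq⟩ := exists_hadamard f hf
  set u : Fin (n + n) → A := Fin.append v w with hu
  have hp : ∀ j : Fin (n + n), ContDiff ℝ ∞ (fun z : Fin (n + n) → ℝ => z j) := fun j =>
    contDiff_apply ℝ ℝ j
  have h1 : ContDiff ℝ ∞ (fun z : Fin (n + n) → ℝ => f (fun i => z (Fin.castAdd n i))) :=
    hf.comp (contDiff_pi.2 fun i => hp _)
  have h2 : ContDiff ℝ ∞ (fun z : Fin (n + n) → ℝ => f (fun i => z (Fin.natAdd n i))) :=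
    hf.comp (contDiff_pi.2 fun i => hp _)
  have e1 : op _ h1 u = op f hf v := by
    rw [op_comp f hf (fun i z => z (Fin.castAdd n i)) (fun i => hp _) h1 u]
    congr 1
    funext i
    rw [op_proj, hu, Fin.append_left]
  have e2 : op _ h2 u = op f hf w := by
    rw [op_comp f hf (fun i z => z (Fin.natAdd n i)) (fun i => hp _) h2 u]
    congr 1
    funext i
    rw [op_proj, hu, Fin.append_right]
  have h3 : ∀ i : Fin n, ContDiff ℝ ∞ (fun z : Fin (n + n) → ℝ =>
      (z (Fin.castAdd n i) - z (Fin.natAdd n i)) * h i z) := fun i =>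
    ((hp _).sub (hp _)).mul (hh i)
  rw [← e1, ← e2, ← op_sub_fun h1 h2 (h1.sub h2),
    op_congr (h1.sub h2) (ContDiff.sum fun i _ => h3 i) heq, op_sum_fun _ _ h3]
  refine Ideal.sum_mem _ fun i _ => ?_
  rw [op_mul_fun ((hp _).sub (hp _)) (hh i), op_sub_fun (hp _) (hp _), op_proj, op_proj,
    hu, Fin.append_left, Fin.append_right]
  exact Ideal.mul_mem_right _ _ (hvw i)

/-- The smooth operations on `A ⧸ I`, computed on representatives. -/
def quotientOp (I : Ideal A) {n : ℕ} (f : (Fin n → ℝ) → ℝ) (hf : ContDiff ℝ ∞ f)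
    (v : Fin n → A ⧸ I) : A ⧸ I :=
  Ideal.Quotient.mk I (op f hf fun i => Quotient.out (v i))

theorem quotientOp_mk (I : Ideal A) {n : ℕ} (f : (Fin n → ℝ) → ℝ) (hf : ContDiff ℝ ∞ f)
    (v : Fin n → A) :
    quotientOp I f hf (fun i => Ideal.Quotient.mk I (v i)) =
      Ideal.Quotient.mk I (op f hf v) := by
  refine Ideal.Quotient.eq.2 (op_sub_op_mem I f hf _ _ fun i => Ideal.Quotient.eq.1 ?_)
  exact Quotient.out_eq _

/-- The quotient of a `C^∞`-ring by an ideal is a `C^∞`-ring. -/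
instance quotient (I : Ideal A) : CInfRing (A ⧸ I) where
  op f hf v := quotientOp I f hf v
  op_proj i h v := by
    obtain ⟨w, rfl⟩ : ∃ w : _ → A, v = fun i => Ideal.Quotient.mk I (w i) :=
      ⟨fun i => Quotient.out (v i), funext fun i => (Quotient.out_eq (v i)).symm⟩
    rw [quotientOp_mk, op_proj]
  op_comp f hf g hg h v := by
    obtain ⟨w, rfl⟩ : ∃ w : _ → A, v = fun i => Ideal.Quotient.mk I (w i) :=
      ⟨fun i => Quotient.out (v i), funext fun i => (Quotient.out_eq (v i)).symm⟩
    simp only [quotientOp_mk]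
    rw [op_comp f hf g hg]
  op_add h v := by
    obtain ⟨w, rfl⟩ : ∃ w : _ → A, v = fun i => Ideal.Quotient.mk I (w i) :=
      ⟨fun i => Quotient.out (v i), funext fun i => (Quotient.out_eq (v i)).symm⟩
    rw [quotientOp_mk, op_add, map_add]
  op_mul h v := by
    obtain ⟨w, rfl⟩ : ∃ w : _ → A, v = fun i => Ideal.Quotient.mk I (w i) :=
      ⟨fun i => Quotient.out (v i), funext fun i => (Quotient.out_eq (v i)).symm⟩
    rw [quotientOp_mk, op_mul, map_mul]
  op_const c h v := by
    obtain ⟨w, rfl⟩ : ∃ w : _ → A, v = fun i => Ideal.Quotient.mk I (w i) :=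
      ⟨fun i => Quotient.out (v i), funext fun i => (Quotient.out_eq (v i)).symm⟩
    rw [quotientOp_mk, op_const]
    rfl

end CInfRing

/-! ### The localization `A{a⁻¹}` in the category of `C^∞`-rings -/

section Localization

variable {A : Type*} [CommRing A] [Algebra ℝ A] [CInfRing A]

/-- Formal smooth expressions in the elements of `A` and one further symbol `inv`. -/
inductive LocTerm (A : Type*) : Type _
  | of : A → LocTerm A
  | inv : LocTerm A
  | op : {n : ℕ} → (f : (Fin n → ℝ) → ℝ) → ContDiff ℝ ∞ f → (Fin n → LocTerm A) → LocTerm A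

/-- The congruence on formal expressions generated by the laws of a `C^∞`-ring, by the requirement
that `A → A{a⁻¹}` is a morphism of `C^∞`-rings, and by `a * inv = 1`. -/
inductive LocRel (a : A) : LocTerm A → LocTerm A → Prop
  | refl (s) : LocRel a s s
  | symm {s t} : LocRel a s t → LocRel a t s
  | trans {s t u} : LocRel a s t → LocRel a t u → LocRel a s u
  | congr {n : ℕ} (f : (Fin n → ℝ) → ℝ) (hf : ContDiff ℝ ∞ f) (v w : Fin n → LocTerm A) :
      (∀ i, LocRel a (v i) (w i)) → LocRel a (.op f hf v) (.op f hf w)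
  | proj {n : ℕ} (i : Fin n) (h : ContDiff ℝ ∞ (fun x : Fin n → ℝ => x i))
      (v : Fin n → LocTerm A) : LocRel a (.op (fun x : Fin n → ℝ => x i) h v) (v i)
  | comp {m n : ℕ} (f : (Fin m → ℝ) → ℝ) (hf : ContDiff ℝ ∞ f)
      (g : Fin m → (Fin n → ℝ) → ℝ) (hg : ∀ i, ContDiff ℝ ∞ (g i))
      (h : ContDiff ℝ ∞ (fun x => f (fun i => g i x))) (v : Fin n → LocTerm A) :
      LocRel a (.op (fun x => f (fun i => g i x)) h v) (.op f hf (fun i => .op (g i) (hg i) v))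
  | of_op {n : ℕ} (f : (Fin n → ℝ) → ℝ) (hf : ContDiff ℝ ∞ f) (v : Fin n → A) :
      LocRel a (.of (SmoothOps.op f hf v)) (.op f hf (fun i => .of (v i)))
  | mul_inv (h : ContDiff ℝ ∞ (fun x : Fin 2 → ℝ => x 0 * x 1)) :
      LocRel a (.op (fun x : Fin 2 → ℝ => x 0 * x 1) h ![.of a, .inv]) (.of 1)

/-- The setoid of `LocRel`. -/
def locSetoid (a : A) : Setoid (LocTerm A) :=
  ⟨LocRel a, LocRel.refl, LocRel.symm, LocRel.trans⟩

/-- The localization `A{a⁻¹}`: the initial `C^∞`-ring under `A` in which `a` is invertible. -/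
def SmoothLocalization (a : A) : Type _ := Quotient (locSetoid a)

namespace SmoothLocalization

variable (a : A)

/-- The smooth operations on `A{a⁻¹}`, computed on representatives. -/
def locOp {n : ℕ} (f : (Fin n → ℝ) → ℝ) (hf : ContDiff ℝ ∞ f)
    (v : Fin n → SmoothLocalization a) : SmoothLocalization a :=
  Quotient.mk (locSetoid a) (.op f hf fun i => Quotient.out (v i))

theorem locOp_mk {n : ℕ} (f : (Fin n → ℝ) → ℝ) (hf : ContDiff ℝ ∞ f) (v : Fin n → LocTerm A) :
    locOp a f hf (fun i => Quotient.mk (locSetoid a) (v i)) =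
      Quotient.mk (locSetoid a) (.op f hf v) :=
  Quotient.sound (LocRel.congr f hf _ _ fun i => Quotient.mk_out (s := locSetoid a) (v i))

instance : SmoothOps (SmoothLocalization a) where
  op f hf v := locOp a f hf v
  op_proj i h v := by
    obtain ⟨w, rfl⟩ : ∃ w : _ → LocTerm A, v = fun i => Quotient.mk (locSetoid a) (w i) :=
      ⟨fun i => Quotient.out (v i), funext fun i => (Quotient.out_eq (v i)).symm⟩
    rw [locOp_mk]
    exact Quotient.sound (LocRel.proj i h w)
  op_comp f hf g hg h v := by
    obtain ⟨w, rfl⟩ : ∃ w : _ → LocTerm A, v = fun i => Quotient.mk (locSetoid a) (w i) :=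
      ⟨fun i => Quotient.out (v i), funext fun i => (Quotient.out_eq (v i)).symm⟩
    simp only [locOp_mk]
    exact Quotient.sound (LocRel.comp f hf g hg h w)

instance : CommRing (SmoothLocalization a) := SmoothOps.toCommRing _

instance : Algebra ℝ (SmoothLocalization a) := SmoothOps.toAlgebra _

instance : CInfRing (SmoothLocalization a) := SmoothOps.toCInfRing _

end SmoothLocalization

end Localization

/-! ### The radicals -/

section Radicals

variable {A : Type*} [CommRing A] [Algebra ℝ A]

/-- The `∞`-radical of `I`: all `f` such that `(A ⧸ I){f⁻¹}` is the zero ring. -/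
def inftyRadical [CInfRing A] (I : Ideal A) : Set A :=
  {f | Subsingleton (SmoothLocalization (Ideal.Quotient.mk I f))}

/-- The `ℝ`-Jacobson radical of `I`: the intersection of all maximal ideals that contain `I` and
have `ℝ` as the residue field (all of `A` if there are none). -/
def realJacobson (I : Ideal A) : Ideal A :=
  sInf {m | I ≤ m ∧ m.IsMaximal ∧ Nonempty ((A ⧸ m) ≃ₐ[ℝ] ℝ)}

end Radicals

/-! ### The `C^∞`-ring `C^∞(ℝ)` and three of its ideals -/

/-- The ring `C^∞(ℝ)` of smooth functions `ℝ → ℝ`. -/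
abbrev SmoothReal : Type := C^∞⟮𝓘(ℝ, ℝ), ℝ; 𝓘(ℝ, ℝ), ℝ⟯

theorem SmoothReal.contDiff (f : SmoothReal) : ContDiff ℝ ∞ f :=
  contMDiff_iff_contDiff.1 f.contMDiff

/-- `C^∞(ℝ)` is a `C^∞`-ring through composition of functions. -/
instance : CInfRing SmoothReal where
  op f hf v := ⟨fun x => f (fun i => v i x), contMDiff_iff_contDiff.2
    (hf.comp (contDiff_pi.2 fun i => (v i).contDiff))⟩
  op_proj _ _ _ := rfl
  op_comp _ _ _ _ _ _ := rfl
  op_add _ _ := rfl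
  op_mul _ _ := rfl
  op_const _ _ _ := rfl

/-- The ideal of functions that are flat at `0`, i.e. whose Taylor series at `0` vanishes. -/
def flatIdeal : Ideal SmoothReal where
  carrier := {f | ∀ k : ℕ, iteratedDeriv k f 0 = 0}
  zero_mem' k := by
    change iteratedDeriv k (fun _ : ℝ => (0 : ℝ)) 0 = 0
    simp
  add_mem' {f g} hf hg k := by
    change iteratedDeriv k (⇑f + ⇑g) 0 = 0
    rw [iteratedDeriv_add (f.contDiff.contDiffAt.of_le (by exact_mod_cast le_top))
      (g.contDiff.contDiffAt.of_le (by exact_mod_cast le_top)), hf k, hg k, add_zero]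
  smul_mem' g f hf k := by
    change iteratedDeriv k (⇑g * ⇑f) 0 = 0
    rw [iteratedDeriv_mul (g.contDiff.contDiffAt.of_le (by exact_mod_cast le_top))
      (f.contDiff.contDiffAt.of_le (by exact_mod_cast le_top))]
    exact Finset.sum_eq_zero fun i _ => by rw [hf (k - i), mul_zero]

/-- The ideal of functions whose germ at `0` is zero. -/
def zeroGermIdeal : Ideal SmoothReal where
  carrier := {f | ∀ᶠ x in 𝓝 (0 : ℝ), f x = 0}
  zero_mem' := Filter.Eventually.of_forall fun _ => rfl
  add_mem' {f g} hf hg := by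
    filter_upwards [hf, hg] with x h1 h2
    change f x + g x = 0
    rw [h1, h2, add_zero]
  smul_mem' g f hf := by
    filter_upwards [hf] with x h
    change g x * f x = 0
    rw [h, mul_zero]

/-- The ideal of functions with compact support. -/
def compactSupportIdeal : Ideal SmoothReal where
  carrier := {f | HasCompactSupport f}
  zero_mem' := HasCompactSupport.zero
  add_mem' {f g} hf hg := HasCompactSupport.add (f := ⇑f) (f' := ⇑g) hf hg
  smul_mem' g f hf := HasCompactSupport.mul_left (f := ⇑g) (f' := ⇑f) hf

end

noncomputable section

open SmoothOps Filter

/-! ### Morphisms of `C^∞`-rings -/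

/-! The chain rests on the universal property of A{a⁻¹}, used in one direction: if A{a⁻¹} is zero,
then so is every C^∞-ring under A in which a is invertible (`subsingleton_of_invertible`). If f^k ∈
I, the class of f becomes both nilpotent and invertible, so the localization is zero. If f lies
outside a maximal ideal m ⊇ I, then A/m is a nonzero C^∞-ring under A/I in which f is invertible, so
f is not in the ∞-radical. The last inclusion holds because fewer ideals are intersected.

For the first two strict inclusions the witness is the coordinate x. Flat functions: exp(-1/|x|) is
flat and vanishes only at 0. If g ∈ I vanishes only where f does, then with y inverse to f the
function step(f(x)y)/g(x) is smooth on ℝ², and multiplying it by g = 0 gives step(1) = 1. Hence f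
lies in the ∞-radical (`mem_inftyRadical_of_zeros`). No power of x is flat. Zero germs: the germs at
0 form a local ring whose maximal ideal contains x, so x ∈ J(I). But x is invertible on punctured
neighbourhoods of 0, so the localization is not zero. Compact support: a maximal ideal with residue
field ℝ contains x - c for some c, and a bump function at c turns (x - c)² into a unit of the ideal.
So no such ideal contains I and J_ℝ(I) is everything, while J(I) is proper because I is. -/

/-- A map is a morphism of `C^∞`-rings if it commutes with all smooth operations. -/
def PreservesOps {A B : Type*} [SmoothOps A] [SmoothOps B] (φ : A → B) : Prop :=
  ∀ (n : ℕ) (f : (Fin n → ℝ) → ℝ) (hf : ContDiff ℝ ∞ f) (v : Fin n → A),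
    φ (op f hf v) = op f hf (fun i => φ (v i))

namespace PreservesOps

theorem comp {A B C : Type*} [SmoothOps A] [SmoothOps B] [SmoothOps C] {ψ : B → C} {φ : A → B}
    (hψ : PreservesOps ψ) (hφ : PreservesOps φ) : PreservesOps (ψ ∘ φ) := by
  intro n f hf v
  simp only [Function.comp_apply, hφ n f hf v, hψ n f hf]

variable {A B : Type*} [CommRing A] [Algebra ℝ A] [CInfRing A] [CommRing B] [Algebra ℝ B]
  [CInfRing B] {φ : A → B}

/-- Real constants are nullary operations, and the ring operations are smooth as well. So a bare map
that preserves operations respects the whole algebra structure. -/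
theorem map_algebraMap (hφ : PreservesOps φ) (c : ℝ) :
    φ (algebraMap ℝ A c) = algebraMap ℝ B c := by
  rw [← CInfRing.op_const c contDiff_const ![], hφ, CInfRing.op_const]

theorem map_zero (hφ : PreservesOps φ) : φ 0 = 0 := by
  simpa using hφ.map_algebraMap 0

theorem map_one (hφ : PreservesOps φ) : φ 1 = 1 := by
  simpa using hφ.map_algebraMap 1

theorem map_mul (hφ : PreservesOps φ) (a b : A) : φ (a * b) = φ a * φ b := by
  have h := CInfRing.op_mul (A := A) (by fun_prop) ![a, b]
  simp only [Matrix.cons_val_zero, Matrix.cons_val_one] at h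
  rw [← h, hφ, CInfRing.op_mul]
  rfl

theorem map_pow (hφ : PreservesOps φ) (a : A) (k : ℕ) : φ (a ^ k) = φ a ^ k := by
  induction k with
  | zero => simp [hφ.map_one]
  | succ k ih => rw [pow_succ, hφ.map_mul, ih, pow_succ]

/-- A ring homomorphism out of a quotient preserves the operations if its composition with the
quotient map does. -/
theorem quotientLift {I : Ideal A} {φ : A →+* B} (hφ : PreservesOps φ)
    (hI : ∀ a ∈ I, φ a = 0) : PreservesOps (Ideal.Quotient.lift I φ hI) := by
  intro n f hf v
  obtain ⟨w, rfl⟩ : ∃ w : _ → A, v = fun i => Ideal.Quotient.mk I (w i) :=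
    ⟨fun i => Quotient.out (v i), funext fun i => (Quotient.out_eq (v i)).symm⟩
  have h : op f hf (fun i => Ideal.Quotient.mk I (w i)) = Ideal.Quotient.mk I (op f hf w) :=
    CInfRing.quotientOp_mk I f hf w
  rw [h]
  simp only [Ideal.Quotient.lift_mk]
  exact hφ n f hf w

end PreservesOps

theorem preservesOps_quotientMk {A : Type*} [CommRing A] [Algebra ℝ A] [CInfRing A]
    (I : Ideal A) : PreservesOps (Ideal.Quotient.mk I) :=
  fun _ f hf v => (CInfRing.quotientOp_mk I f hf v).symm

/-! ### The localization -/

namespace SmoothLocalization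

variable {A : Type*} [CommRing A] [Algebra ℝ A] [CInfRing A]

/-- The structure map `A → A{a⁻¹}`. -/
def of (a : A) (x : A) : SmoothLocalization a := Quotient.mk (locSetoid a) (.of x)

/-- The inverse of `a` in `A{a⁻¹}`. -/
def inv (a : A) : SmoothLocalization a := Quotient.mk (locSetoid a) .inv

theorem preservesOps_of (a : A) : PreservesOps (of a) := fun _ f hf v =>
  (Quotient.sound (LocRel.of_op f hf v)).trans (locOp_mk a f hf fun i => .of (v i)).symm

theorem of_mul_inv (a : A) : of a a * inv a = 1 := by
  have h : ContDiff ℝ ∞ (fun x : Fin 2 → ℝ => x 0 * x 1) := by fun_prop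
  rw [← (preservesOps_of a).map_one]
  refine Eq.trans ?_ (Quotient.sound (s := locSetoid a) (LocRel.mul_inv h))
  refine Eq.trans ?_ (locOp_mk a _ h _)
  refine (CInfRing.op_mul h ![of a a, inv a]).symm.trans ?_
  change locOp a _ h _ = _
  congr 1
  funext i
  fin_cases i <;> rfl

variable {B : Type*} [CommRing B] [Algebra ℝ B] [CInfRing B]

/-- The value of a formal expression in a `C^∞`-ring under `A`. -/
def eval (φ : A → B) (b : B) : LocTerm A → B
  | .of x => φ x
  | .inv => b
  | .op f hf v => op f hf (fun i => eval φ b (v i))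

/-- Soundness of the congruence: each generating relation becomes a true identity in B, the last one
because b inverts φ a. This is the existence half of the universal property. -/
theorem eval_eq_of_locRel {φ : A → B} (hφ : PreservesOps φ) {a : A} {b : B} (hab : φ a * b = 1)
    {s t : LocTerm A} (h : LocRel a s t) : eval φ b s = eval φ b t := by
  induction h with
  | refl => rfl
  | symm _ ih => exact ih.symm
  | trans _ _ ih₁ ih₂ => exact ih₁.trans ih₂
  | congr f hf v w _ ih => simp only [eval, ih]
  | proj i h v => exact op_proj i h _
  | comp f hf g hg h v => exact op_comp f hf g hg h _
  | of_op f hf v => exact hφ _ f hf v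
  | mul_inv h =>
    simp only [eval]
    rw [CInfRing.op_mul, hφ.map_one]
    exact hab

/-- If `A{a⁻¹}` is zero, so is every `C^∞`-ring under `A` in which `a` is invertible. -/
theorem subsingleton_of_invertible {a : A} (h : Subsingleton (SmoothLocalization a)) {φ : A → B}
    (hφ : PreservesOps φ) {b : B} (hab : φ a * b = 1) : Subsingleton B := by
  -- Collapse of the quotient means that 0 and 1 are formally related; evaluating this relation in B
  -- gives 0 = 1 there.
  have h01 : LocRel a (.of 0) (.of 1) :=
    Quotient.exact (s := locSetoid a) (Subsingleton.elim (of a 0) (of a 1))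
  have := eval_eq_of_locRel hφ hab h01
  simp only [eval, hφ.map_zero, hφ.map_one] at this
  exact subsingleton_of_zero_eq_one this

end SmoothLocalization

/-! ### The chain of inclusions -/

section Inclusions

variable {A : Type*} [CommRing A] [Algebra ℝ A] [CInfRing A]

theorem radical_subset_inftyRadical (I : Ideal A) : (I.radical : Set A) ⊆ inftyRadical I := by
  -- Here k = 0 is allowed: it forces 1 ∈ I, and the computation below covers it.
  rintro f ⟨k, hk⟩
  set a := Ideal.Quotient.mk I f with ha
  have hof := SmoothLocalization.preservesOps_of a
  have h0 : SmoothLocalization.of a a ^ k = 0 := by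
    rw [← hof.map_pow, ha, ← map_pow, Ideal.Quotient.eq_zero_iff_mem.2 hk, hof.map_zero]
  refine subsingleton_of_zero_eq_one (M₀ := SmoothLocalization a) ?_
  rw [← one_pow k, ← SmoothLocalization.of_mul_inv a, mul_pow, h0, zero_mul]

/-- If `f` lies in the `∞`-radical of `I`, every `C^∞`-ring under `A` in which `I` becomes zero
and `f` becomes invertible is zero. -/
theorem subsingleton_of_mem_inftyRadical {B : Type*} [CommRing B] [Algebra ℝ B] [CInfRing B]
    {I : Ideal A} {f : A} (hf : f ∈ inftyRadical I) {φ : A →+* B} (hφ : PreservesOps φ)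
    (hI : ∀ x ∈ I, φ x = 0) {b : B} (hb : φ f * b = 1) : Subsingleton B :=
  SmoothLocalization.subsingleton_of_invertible hf (hφ.quotientLift hI) hb

/-- A residue field A/m is itself a C^∞-ring, since every ideal is a congruence for smooth
operations; it can therefore be tested against the universal property. -/
theorem inftyRadical_subset_jacobson (I : Ideal A) : inftyRadical I ⊆ (I.jacobson : Set A) := by
  intro f hf
  rw [SetLike.mem_coe, Ideal.jacobson, Ideal.mem_sInf]
  rintro m ⟨hIm, hm⟩
  by_contra hfm
  obtain ⟨b, hb⟩ := Ideal.Quotient.exists_inv (I := m)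
    (a := Ideal.Quotient.mk m f) (by rwa [Ne, Ideal.Quotient.eq_zero_iff_mem])
  have := subsingleton_of_mem_inftyRadical hf (preservesOps_quotientMk m)
    (fun x hx => Ideal.Quotient.eq_zero_iff_mem.2 (hIm hx)) hb
  exact hm.ne_top (Ideal.Quotient.subsingleton_iff.1 this)

theorem jacobson_le_realJacobson {A : Type*} [CommRing A] [Algebra ℝ A] (I : Ideal A) : I.jacobson ≤ realJacobson I :=
  sInf_le_sInf fun _ hm => ⟨hm.1, hm.2.1⟩

end Inclusions

/-! ### Smooth functions on the line -/

/-- A smooth step: zero near `0` and equal to `1` on a neighbourhood of `1`. -/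
def smoothStep (s : ℝ) : ℝ := Real.smoothTransition (4 * s - 1)

theorem contDiff_smoothStep : ContDiff ℝ ∞ smoothStep :=
  Real.smoothTransition.contDiff.comp (by fun_prop)

theorem smoothStep_eq_zero {s : ℝ} (h : s < 1 / 4) : smoothStep s = 0 :=
  Real.smoothTransition.zero_of_nonpos (by linarith)

theorem smoothStep_eq_one {s : ℝ} (h : 1 / 2 < s) : smoothStep s = 1 :=
  Real.smoothTransition.one_of_one_le (by linarith)

/-- The quotient `smoothStep ∘ p / q` is smooth when `p` vanishes at the zeros of `q`. -/
theorem contDiff_smoothStep_div {E : Type*} [NormedAddCommGroup E] [NormedSpace ℝ E]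
    {p q : E → ℝ} (hp : ContDiff ℝ ∞ p) (hq : ContDiff ℝ ∞ q) (h : ∀ x, q x = 0 → p x = 0) :
    ContDiff ℝ ∞ (fun x => smoothStep (p x) / q x) := by
  refine contDiff_iff_contDiffAt.2 fun x => ?_
  by_cases hx : q x = 0
  -- Near a zero of q the numerator vanishes identically, so the quotient is locally 0 whatever the
  -- denominator does.
  · have hev : ∀ᶠ y in 𝓝 x, p y < 1 / 4 :=
      hp.continuous.continuousAt.eventually_lt continuousAt_const (by rw [h x hx]; norm_num)
    refine (contDiffAt_const (c := (0 : ℝ))).congr_of_eventuallyEq ?_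
    filter_upwards [hev] with y hy
    rw [smoothStep_eq_zero hy, zero_div]
  · exact (contDiff_smoothStep.comp hp).contDiffAt.div hq.contDiffAt hx

namespace SmoothReal

/-- A smooth function as an element of `C^∞(ℝ)`. -/
def mk (f : ℝ → ℝ) (hf : ContDiff ℝ ∞ f) : SmoothReal := ⟨f, contMDiff_iff_contDiff.2 hf⟩

/-- The coordinate function. -/
def coord : SmoothReal := mk (fun x => x) contDiff_id

/-- C^∞(ℝ) is generated by the coordinate: f is the unary operation f applied to it, so the image of
the coordinate determines a morphism. -/
theorem map_eq_op {B : Type*} [SmoothOps B] {φ : SmoothReal → B} (hφ : PreservesOps φ)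
    (f : SmoothReal) (h : ContDiff ℝ ∞ (fun x : Fin 1 → ℝ => f (x 0))) :
    φ f = op (fun x : Fin 1 → ℝ => f (x 0)) h ![φ coord] := by
  have : f = op (fun x : Fin 1 → ℝ => f (x 0)) h ![coord] := rfl
  refine (congrArg φ this).trans ((hφ _ _ h _).trans ?_)
  congr 1
  funext i
  fin_cases i
  rfl

theorem isUnit_of_ne_zero (f : SmoothReal) (h : ∀ x, f x ≠ 0) : IsUnit f := by
  refine IsUnit.of_mul_eq_one (mk (fun x => (f x)⁻¹) (f.contDiff.inv h)) ?_
  ext x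
  exact mul_inv_cancel₀ (h x)

end SmoothReal

open SmoothReal

/-- If all zeros of some `g ∈ I` are zeros of `f`, then `f` is in the `∞`-radical of `I`. -/
theorem mem_inftyRadical_of_zeros {I : Ideal SmoothReal} {f g : SmoothReal} (hg : g ∈ I)
    (hfg : ∀ x, g x = 0 → f x = 0) : f ∈ inftyRadical I := by
  set a := Ideal.Quotient.mk I f with ha
  set φ : SmoothReal → SmoothLocalization a :=
    SmoothLocalization.of a ∘ Ideal.Quotient.mk I with hφ_def
  have hφ : PreservesOps φ :=
    (SmoothLocalization.preservesOps_of a).comp (preservesOps_quotientMk I)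
  have hφg : φ g = 0 := by
    rw [hφ_def, Function.comp_apply, Ideal.Quotient.eq_zero_iff_mem.2 hg]
    exact (SmoothLocalization.preservesOps_of a).map_zero
  have hfb : φ f * SmoothLocalization.inv a = 1 := SmoothLocalization.of_mul_inv a
  -- The pair (x, 1/f) in the localization. Identities between smooth functions on ℝ² will be
  -- evaluated at it.
  set v : Fin 2 → SmoothLocalization a := ![φ coord, SmoothLocalization.inv a] with hv
  have hcoe : ∀ u : SmoothReal, ContDiff ℝ ∞ (fun x : Fin 2 → ℝ => u (x 0)) := fun u =>
    u.contDiff.comp (contDiff_apply ℝ ℝ 0)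
  have hval : ∀ u : SmoothReal, op _ (hcoe u) v = φ u := fun u => by
    have h1 : ContDiff ℝ ∞ (fun x : Fin 1 → ℝ => u (x 0)) :=
      u.contDiff.comp (contDiff_apply ℝ ℝ 0)
    rw [map_eq_op hφ u h1]
    refine (op_comp _ h1 (fun _ x => x 0) (fun _ => contDiff_apply ℝ ℝ 0) (hcoe u) v).trans ?_
    congr 1
    funext i
    fin_cases i
    exact op_proj _ _ _
  have hp : ContDiff ℝ ∞ (fun x : Fin 2 → ℝ => f (x 0) * x 1) :=
    (hcoe f).mul (contDiff_apply ℝ ℝ 1)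
  have hpv : op _ hp v = 1 := by
    rw [CInfRing.op_mul_fun (hcoe f) (contDiff_apply ℝ ℝ 1), hval, op_proj]
    exact hfb
  -- On ℝ² the zeros of g(x) are zeros of f(x)y, which makes this quotient smooth even though 1/g is
  -- not.
  have hK : ContDiff ℝ ∞ (fun x : Fin 2 → ℝ => smoothStep (f (x 0) * x 1) / g (x 0)) :=
    contDiff_smoothStep_div hp (hcoe g) fun x hx => by rw [hfg _ hx, zero_mul]
  have hs1 : ContDiff ℝ ∞ (fun x : Fin 1 → ℝ => smoothStep (x 0)) :=
    contDiff_smoothStep.comp (contDiff_apply ℝ ℝ 0)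
  have hs : ContDiff ℝ ∞ (fun x : Fin 2 → ℝ => smoothStep (f (x 0) * x 1)) :=
    contDiff_smoothStep.comp hp
  have key : op _ hK v * op _ (hcoe g) v = op _ hs v := by
    rw [← CInfRing.op_mul_fun hK (hcoe g) (hK.mul (hcoe g))]
    refine op_congr _ _ (fun x => ?_) v
    by_cases hx : g (x 0) = 0
    · rw [hx, hfg _ hx, mul_zero, zero_mul, smoothStep_eq_zero (by norm_num)]
    · exact div_mul_cancel₀ _ hx
  have hone : op _ hs v = 1 := by
    refine (op_comp _ hs1 (fun _ x => f (x 0) * x 1) (fun _ => hp) hs v).trans ?_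
    -- Applying the step operation to the element 1 is composition with a nullary constant, which
    -- gives the constant step(1) = 1.
    have h1 := op_comp (A := SmoothLocalization a) _ hs1 (fun _ _ => 1)
      (fun _ => contDiff_const) contDiff_const ![]
    simp only [CInfRing.op_const, smoothStep_eq_one (by norm_num : (1 / 2 : ℝ) < 1),
      map_one] at h1
    rw [hpv]
    exact h1.symm
  refine subsingleton_of_zero_eq_one (M₀ := SmoothLocalization a) ?_
  rw [← hone, ← key, hval, hφg, mul_zero]

/-! ### Functions that are flat at `0` -/

/-- All derivatives vanish on the open half-line, and by continuity on its closure, which contains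
0. -/
theorem iteratedDeriv_eq_zero_of_zero_Iio {f : ℝ → ℝ} (hf : ContDiff ℝ ∞ f)
    (h : ∀ x < 0, f x = 0) (k : ℕ) : iteratedDeriv k f 0 = 0 := by
  have hc : Continuous (iteratedDeriv k f) :=
    hf.continuous_iteratedDeriv k (by exact_mod_cast le_top)
  have hz : ∀ x ∈ Set.Iio (0 : ℝ), iteratedDeriv k f x = 0 := fun x hx => by
    have : f =ᶠ[𝓝 x] fun _ => 0 := by
      filter_upwards [Iio_mem_nhds hx] with y hy using h y hy
    rw [(this.iteratedDeriv k).eq_of_nhds]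
    simp
  have hcl : IsClosed {x | iteratedDeriv k f x = 0} := isClosed_eq hc continuous_const
  exact hcl.closure_subset_iff.2 hz (by rw [closure_Iio]; exact Set.self_mem_Iic)

/-- The function `exp (-1 / |x|)`, which is flat at `0` and has no further zeros. -/
def flatFunction : SmoothReal :=
  mk (fun x => expNegInvGlue x + expNegInvGlue (-x))
    (expNegInvGlue.contDiff.add (expNegInvGlue.contDiff.comp contDiff_neg))

theorem flatFunction_mem : flatFunction ∈ flatIdeal := by
  intro k
  have h1 : ContDiff ℝ ∞ expNegInvGlue := expNegInvGlue.contDiff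
  have h2 : ContDiff ℝ ∞ (fun x => expNegInvGlue (-x)) := h1.comp contDiff_neg
  have hz := iteratedDeriv_eq_zero_of_zero_Iio h1
    (fun x hx => expNegInvGlue.zero_of_nonpos hx.le) k
  change iteratedDeriv k (expNegInvGlue + fun x => expNegInvGlue (-x)) 0 = 0
  rw [iteratedDeriv_add (h1.contDiffAt.of_le (by exact_mod_cast le_top))
    (h2.contDiffAt.of_le (by exact_mod_cast le_top)), iteratedDeriv_comp_neg, neg_zero, hz]
  simp

theorem flatFunction_eq_zero {x : ℝ} (h : flatFunction x = 0) : x = 0 := by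
  change expNegInvGlue x + expNegInvGlue (-x) = 0 at h
  have h1 := expNegInvGlue.nonneg x
  have h2 := expNegInvGlue.nonneg (-x)
  have h3 := expNegInvGlue.zero_iff_nonpos.1 (by linarith : expNegInvGlue x = 0)
  have h4 := expNegInvGlue.zero_iff_nonpos.1 (by linarith : expNegInvGlue (-x) = 0)
  linarith

theorem coord_mem_inftyRadical_flatIdeal : coord ∈ inftyRadical flatIdeal :=
  mem_inftyRadical_of_zeros flatFunction_mem fun _ hx => flatFunction_eq_zero hx

theorem coord_notMem_radical_flatIdeal : coord ∉ flatIdeal.radical := by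
  rintro ⟨k, hk⟩
  -- The k-th derivative of x^k at 0 is k!, which is not zero.
  have h : iteratedDeriv k (fun x : ℝ => x ^ k) 0 = 0 := by
    have hfun : ⇑(coord ^ k) = fun x : ℝ => x ^ k := by
      rw [ContMDiffMap.coe_pow]
      rfl
    rw [← hfun]
    exact hk k
  rw [iteratedDeriv_fun_pow_zero, if_pos rfl] at h
  exact Nat.factorial_ne_zero k (by exact_mod_cast h)

/-! ### Functions with zero germ at `0` -/

/-- If x ∉ m, then 1 = yx + i with i ∈ m, so i(0) = 1. A function that is nonzero at 0 is invertible
modulo I, which puts 1 in m. -/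
theorem coord_mem_jacobson_zeroGermIdeal : coord ∈ zeroGermIdeal.jacobson := by
  rw [Ideal.jacobson, Ideal.mem_sInf]
  rintro m ⟨hIm, hm⟩
  by_contra hx
  obtain ⟨y, hy⟩ := hm.exists_inv hx
  obtain ⟨i, hi, hyi⟩ := hy
  have hival : ∀ t, i t = 1 - y t * t := fun t => by
    have := DFunLike.congr_fun hyi t
    change y t * t + i t = 1 at this
    linarith
  -- A global smooth function equal to 1/i near 0: the step cuts off the zeros of i.
  set r : SmoothReal := mk _ (contDiff_smoothStep_div i.contDiff i.contDiff fun _ h => h)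
  have hr : r * i ∈ m := m.mul_mem_left r hi
  have hr1 : 1 - r * i ∈ zeroGermIdeal := by
    have hev : ∀ᶠ t in 𝓝 (0 : ℝ), 1 / 2 < i t :=
      continuousAt_const.eventually_lt i.contDiff.continuous.continuousAt
        (by rw [hival]; norm_num)
    filter_upwards [hev] with t ht
    change 1 - smoothStep (i t) / i t * i t = 0
    rw [div_mul_cancel₀ _ (by linarith), smoothStep_eq_one ht, sub_self]
  refine hm.ne_top ((Ideal.eq_top_iff_one m).2 ?_)
  simpa using m.add_mem (hIm hr1) hr

/-- All functions on a set form a `C^∞`-ring under pointwise operations. -/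
instance functionCInfRing (S : Type*) : CInfRing (S → ℝ) where
  op f _ v := fun x => f (fun i => v i x)
  op_proj _ _ _ := rfl
  op_comp _ _ _ _ _ _ := rfl
  op_add _ _ := rfl
  op_mul _ _ := rfl
  op_const _ _ _ := rfl

/-- The functions that vanish eventually along a filter. -/
def eventuallyZeroIdeal {S : Type*} (l : Filter S) : Ideal (S → ℝ) where
  carrier := {f | ∀ᶠ x in l, f x = 0}
  zero_mem' := Eventually.of_forall fun _ => rfl
  add_mem' {f g} hf hg := by
    filter_upwards [hf, hg] with x h1 h2
    rw [Pi.add_apply, h1, h2, add_zero]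
  smul_mem' g f hf := by
    filter_upwards [hf] with x h
    rw [smul_eq_mul, Pi.mul_apply, h, mul_zero]

theorem eventuallyZeroIdeal_ne_top {S : Type*} (l : Filter S) [l.NeBot] :
    eventuallyZeroIdeal l ≠ ⊤ := by
  rw [Ne, Ideal.eq_top_iff_one]
  intro h
  obtain ⟨x, hx⟩ := Eventually.exists (f := l) h
  exact one_ne_zero hx

/-- The inclusion of `C^∞(ℝ)` into the ring of all functions. -/
def SmoothReal.toFunction : SmoothReal →+* (ℝ → ℝ) := ContMDiffMap.coeFnRingHom

/-- The test ring consists of germs of arbitrary functions on punctured neighbourhoods of 0. Since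
no smoothness is required there, t⁻¹ is an element at once, and its value at t = 0 is irrelevant. -/
theorem coord_notMem_inftyRadical_zeroGermIdeal : coord ∉ inftyRadical zeroGermIdeal := by
  intro h
  set N := eventuallyZeroIdeal (𝓝[≠] (0 : ℝ))
  have hφ : PreservesOps ((Ideal.Quotient.mk N).comp SmoothReal.toFunction) :=
    (preservesOps_quotientMk N).comp (φ := SmoothReal.toFunction) fun _ _ _ _ => rfl
  refine eventuallyZeroIdeal_ne_top (𝓝[≠] (0 : ℝ)) (Ideal.Quotient.subsingleton_iff.1
    (subsingleton_of_mem_inftyRadical h hφ (fun x hx => ?_)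
      (b := Ideal.Quotient.mk N fun t => t⁻¹) ?_))
  · refine Ideal.Quotient.eq_zero_iff_mem.2 ?_
    exact (show ∀ᶠ t in 𝓝 (0 : ℝ), x t = 0 from hx).filter_mono nhdsWithin_le_nhds
  · rw [RingHom.comp_apply, ← map_mul, ← map_one (Ideal.Quotient.mk N), Ideal.Quotient.eq]
    change ∀ᶠ t in 𝓝[≠] (0 : ℝ), t * t⁻¹ - 1 = 0
    filter_upwards [self_mem_nhdsWithin] with t ht
    rw [mul_inv_cancel₀ ht, sub_self]

/-! ### Functions with compact support -/

theorem realJacobson_compactSupportIdeal : realJacobson compactSupportIdeal = ⊤ := by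
  rw [realJacobson, sInf_eq_top]
  rintro m ⟨hIm, hm, ⟨e⟩⟩
  exfalso
  -- The point of ℝ to which m would have to correspond: the value of the coordinate in the residue
  -- field.
  set c : ℝ := e (Ideal.Quotient.mk m coord) with hc
  have hxc : coord - algebraMap ℝ SmoothReal c ∈ m := by
    rw [← Ideal.Quotient.eq_zero_iff_mem, map_sub, sub_eq_zero]
    exact e.injective (e.commutes c).symm
  -- The radii 1 and 2 are arbitrary; all that matters is that χ is nonnegative, compactly supported
  -- and nonzero at c.
  let χ : ContDiffBump c := ⟨1, 2, one_pos, one_lt_two⟩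
  have hχ : mk χ χ.contDiff ∈ m := hIm χ.hasCompactSupport
  have hmem := m.add_mem (m.mul_mem_left (coord - algebraMap ℝ SmoothReal c) hxc) hχ
  refine hm.ne_top (Ideal.eq_top_of_isUnit_mem _ hmem (isUnit_of_ne_zero _ fun x => ?_))
  change (x - c) * (x - c) + χ x ≠ 0
  refine ne_of_gt ?_
  by_cases hx : x = c
  · have : χ x = 1 := χ.one_of_mem_closedBall (by
      rw [hx]
      exact Metric.mem_closedBall_self zero_le_one)
    rw [this]
    nlinarith
  · have : 0 < (x - c) * (x - c) := mul_self_pos.2 (sub_ne_zero.2 hx)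
    linarith [χ.nonneg' x]

theorem compactSupportIdeal_ne_top : compactSupportIdeal ≠ ⊤ := by
  rw [Ne, Ideal.eq_top_iff_one]
  intro h
  have hc : IsCompact (tsupport fun _ : ℝ => (1 : ℝ)) := h
  rw [tsupport, Function.support_const one_ne_zero, closure_univ] at hc
  exact noncompact_univ ℝ hc

end

theorem mainTheorem9 :
    (∀ (A : Type*) [CommRing A] [Algebra ℝ A] [CInfRing A] (I : Ideal A),
      (I.radical : Set A) ⊆ inftyRadical I ∧
      inftyRadical I ⊆ (I.jacobson : Set A) ∧
      (I.jacobson : Set A) ⊆ (realJacobson I : Set A)) ∧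
    (flatIdeal.radical : Set SmoothReal) ⊂ inftyRadical flatIdeal ∧
    inftyRadical zeroGermIdeal ⊂ (zeroGermIdeal.jacobson : Set SmoothReal) ∧
    (compactSupportIdeal.jacobson : Set SmoothReal) ⊂
      (realJacobson compactSupportIdeal : Set SmoothReal) := by
  refine ⟨fun A _ _ _ I => ⟨radical_subset_inftyRadical I, inftyRadical_subset_jacobson I,
    jacobson_le_realJacobson I⟩, ?_, ?_, ?_⟩
  · exact (Set.ssubset_iff_of_subset (radical_subset_inftyRadical _)).2
      ⟨SmoothReal.coord, coord_mem_inftyRadical_flatIdeal, coord_notMem_radical_flatIdeal⟩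
  · exact (Set.ssubset_iff_of_subset (inftyRadical_subset_jacobson _)).2
      ⟨SmoothReal.coord, coord_mem_jacobson_zeroGermIdeal, coord_notMem_inftyRadical_zeroGermIdeal⟩
  -- With J_ℝ(I) the whole ring, strictness says only that J(I) is proper, which holds exactly when
  -- I is proper.
  · rw [realJacobson_compactSupportIdeal, SetLike.coe_ssubset_coe, lt_top_iff_ne_top, Ne,
      Ideal.jacobson_eq_top_iff]
    exact compactSupportIdeal_ne_top
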